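/- Let $q,k\ge 2$ be integers with $(q,k)\ne(2,2)$, let $n=qk$ and $[n]=\{1,\dots,n\}$. A family $\mathcal F\subseteq 2^{[n]}$ is called union-$q$-efficient if every subfamily of $\mathcal F$ whose union is $[n]$ contains $q$ sets whose union is $[n]$; for unions, $\mathcal F$ is called non-trivial if $\bigcup_{A\in\mathcal F}A=[n]$. A family is called $q$-linked if any $q$ of its members have a common element, and $\mathcal H\subseteq 2^{[n]}$ is called $q$-Helly if all members of any $q$-linked subfamily of $\mathcal H$ have a common element; for intersections, $\mathcal H$ is called non-trivial if no element of $[n]$ lies in all members of $\mathcal H$. Two families on $[n]$ are isomorphic if a permutation of $[n]$ maps one onto the other. Let $\mathcal E\subseteq\binom{[n]}{k}$ be the family consisting of $q$ pairwise disjoint $k$-sets $B_1,\dots,B_q$ (so that $B_1\cup\dots\cup B_q=[n]$), together with all $k$-subsets of $[n]\setminus\{p_1,\dots,p_q\}$, where $p_i\in B_i$ is one fixed element for each $i$; up to isomorphism $\mathcal E$ does not depend on the choices. (1) Every non-trivial union-$q$-efficient family $\mathcal F\subseteq\binom{[n]}{k}$ satisfies $|\mathcal F|\le\binom{n-q}{k}+q$.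 The family $\mathcal E$ is non-trivial and union-$q$-efficient and attains this bound, and every family attaining it is isomorphic to $\mathcal E$. (2) Equivalently, in terms of complements: put $k'=(q-1)k$, so that $n=k'q/(q-1)$. Every non-trivial $q$-Helly family $\mathcal H\subseteq\binom{[n]}{k'}$ satisfies $|\mathcal H|\le\binom{n-q}{k}+q$. The family $\{[n]\setminus A: A\in\mathcal E\}$ is non-trivial and $q$-Helly and attains this bound, and every family attaining it is isomorphic to this one. -/

import Mathlib

/-- A family `F` of subsets of `[n]` is union-`q`-efficient: every subfamily `S` whose union
is `[n]` contains `q` sets whose union is already `[n]`. -/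
def UnionEfficient {n : ℕ} (q : ℕ) (F : Finset (Finset (Fin n))) : Prop :=
  ∀ S ⊆ F, S.sup id = Finset.univ → ∃ T ⊆ S, T.card = q ∧ T.sup id = Finset.univ

/-- Non-triviality for unions: the sets of `F` cover `[n]`. -/
def UnionNontrivial {n : ℕ} (F : Finset (Finset (Fin n))) : Prop :=
  F.sup id = Finset.univ

/-- `H` is `q`-linked: any `q` members of `H` have a common element. -/
def Linked {n : ℕ} (q : ℕ) (H : Finset (Finset (Fin n))) : Prop :=
  ∀ A : Fin q → Finset (Fin n), (∀ i, A i ∈ H) → ∃ x, ∀ i, x ∈ A i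

/-- `H` is a `q`-Helly family: every `q`-linked subfamily has a common element. -/
def HellyFamily {n : ℕ} (q : ℕ) (H : Finset (Finset (Fin n))) : Prop :=
  ∀ S ⊆ H, Linked q S → ∃ x, ∀ A ∈ S, x ∈ A

/-- Non-triviality for intersections: no element of `[n]` lies in all sets of `H`. -/
def InterNontrivial {n : ℕ} (H : Finset (Finset (Fin n))) : Prop :=
  ¬ ∃ x, ∀ A ∈ H, x ∈ A

/-- Two families on `[n]` are isomorphic if a permutation of `[n]` carries one to the other. -/
def FamilyIso {n : ℕ} (F G : Finset (Finset (Fin n))) : Prop :=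
  ∃ σ : Equiv.Perm (Fin n), F.image (fun A => A.image σ) = G

/-- The family of complements of the members of `F`. -/
def complFamily {n : ℕ} (F : Finset (Finset (Fin n))) : Finset (Finset (Fin n)) :=
  F.image (fun A => Finset.univ \ A)

/-- The `i`-th block `{ik, ik + 1, …, ik + k - 1}` of `{0, …, n - 1}`. -/
def block (n k i : ℕ) : Finset (Fin n) :=
  Finset.univ.filter (fun x => x.val / k = i)

/-- For `n = qk`: the `q` disjoint blocks of size `k`, the `i`-th with private element `ik`,
together with all `k`-subsets of the `n - q` elements that are not private
(those that `k` does not divide). -/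
def extremalFamily (n q k : ℕ) : Finset (Finset (Fin n)) :=
  (Finset.range q).image (block n k) ∪
    Finset.powersetCard k (Finset.univ.filter (fun x : Fin n => ¬ k ∣ x.val))

/-!
Let `F` be union-efficient. Every subfamily of `F` covering the ground set contains a partition of
it, because `q` sets of size `k` cover `q * k` points only if they are disjoint. Exchanging parts
between such partitions shows that the disjointness graph on the sets occurring in them, the
essential sets, has no induced path on four vertices. In a cograph every maximal clique meets every
maximal independent set. As partitions are maximal cliques, the members of `F` outside a maximal
independent set `I` contain no partition, so they miss a point; the members of `F` through that
point are exactly those of `I`. Hence there are as many such points as maximal independent sets.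

Distinct essential sets are not nested, so no neighbourhood in the disjointness graph contains
another one, and by induction over the cograph there are at least as many maximal independent sets
as vertices. So if `F` has `m` essential sets, then at least `m` points lie in no other member of
`F`, and `#F ≤ m + (q * k - m).choose k` where `q ≤ m ≤ q * k`. The right-hand side is largest at
`m = q`, where the essential sets form one partition and each of them has a private point. For
`(q, k) = (2, 3)` and `(3, 2)` the value at `m = q * k` is the same, but then the equality case of
the induction gives the wrong sizes of maximal cliques.

For the Helly form, take complements.
-/

section Cograph

open Finset

variable {V : Type*} {G : SimpleGraph V} {W W₁ W₂ U K : Finset V}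

/-- `G` has no induced path on four vertices inside `W`, i.e. the subgraph induced by `W` is a
cograph. A pair at distance two along the path is required to be adjacent in `Gᶜ`, hence distinct;
that `a ≠ d` then follows. -/
def IsCographOn (G : SimpleGraph V) (W : Finset V) : Prop :=
  ∀ a ∈ W, ∀ b ∈ W, ∀ c ∈ W, ∀ d ∈ W,
    G.Adj a b → G.Adj b c → G.Adj c d → Gᶜ.Adj a c → Gᶜ.Adj b d → G.Adj a d

namespace IsCographOn

theorem mono (hG : IsCographOn G W) (hU : U ⊆ W) : IsCographOn G U :=
  fun a ha b hb c hc d hd ↦ hG a (hU ha) b (hU hb) c (hU hc) d (hU hd)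

theorem compl (hG : IsCographOn G W) : IsCographOn Gᶜ W := by
  intro a ha b hb c hc d hd hab hbc hcd hac hbd
  rw [compl_compl] at hac hbd
  have had : a ≠ d := by
    rintro rfl
    exact hcd.2 hac.symm
  refine ⟨had, fun hadj ↦ hbc.2 ?_⟩
  exact (hG c hc a ha d hd b hb hac.symm hadj hbd.symm hcd hab).symm

end IsCographOn

/-- `W` splits into two nonempty parts with all edges of `G` between them. -/
def IsJoinOn (G : SimpleGraph V) [DecidableEq V] (W : Finset V) : Prop :=
  ∃ W₁ W₂ : Finset V, W₁.Nonempty ∧ W₂.Nonempty ∧ G.IsCompleteBetween W₁ W₂ ∧ W = W₁ ∪ W₂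

section Decomposition

variable [DecidableEq V]

theorem isJoinOn_of_subset (hU : U.Nonempty) (hUW : U ⊂ W)
    (h : ∀ a ∈ U, ∀ b ∈ W \ U, G.Adj a b) : IsJoinOn G W :=
  ⟨U, W \ U, hU, sdiff_nonempty.2 hUW.2, h, (union_sdiff_of_subset hUW.1).symm⟩

theorem IsCographOn.adj_or_isJoinOn_compl_insert {v : V} (hv : v ∉ W₁ ∪ W₂)
    (hG : IsCographOn G (insert v (W₁ ∪ W₂))) (h₂ : W₂.Nonempty)
    (h : Gᶜ.IsCompleteBetween W₁ W₂) :
    (∀ a ∈ W₁, G.Adj v a) ∨ IsJoinOn Gᶜ (insert v (W₁ ∪ W₂)) := by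
  classical
  have hv₁ : ∀ a ∈ W₁, a ≠ v := by grind
  have hv₂ : ∀ a ∈ W₂, a ≠ v := by grind
  by_cases hz : ∃ z ∈ W₂, G.Adj v z
  · obtain ⟨z, hz, hvz⟩ := hz
    refine or_iff_not_imp_left.2 fun hW₁ ↦ ?_
    push Not at hW₁
    obtain ⟨u, hu, hvu⟩ := hW₁
    -- An edge from a non-neighbour `a` of `v` to a neighbour `b` would give the path `a b v z`.
    refine isJoinOn_of_subset (U := {a ∈ W₁ | ¬ G.Adj v a}) ⟨u, by simp [hu, hvu]⟩
      ⟨by grind, fun hsub ↦ hv₁ v (mem_filter.1 (hsub (mem_insert_self v _))).1 rfl⟩ ?_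
    intro a ha b hb
    obtain ⟨haW, hva⟩ := mem_filter.1 ha
    have hav : Gᶜ.Adj a v := ⟨hv₁ a haW, fun hadj ↦ hva hadj.symm⟩
    refine ⟨by grind, fun hab ↦ ?_⟩
    have hb' : b = v ∨ b ∈ W₂ ∨ b ∈ W₁ ∧ G.Adj v b := by grind
    obtain rfl | hb | ⟨hb, hvb⟩ := hb'
    · exact hva hab.symm
    · exact (h haW hb).2 hab
    · exact (h haW hz).2 <| hG a (by simp [haW]) b (by simp [hb]) v (by simp) z (by simp [hz])
        hab hvb.symm hvz hav (h hb hz)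
  · push Not at hz
    refine .inr (isJoinOn_of_subset (U := W₂) h₂
      ⟨by grind, fun hsub ↦ hv₂ v (hsub (mem_insert_self v _)) rfl⟩ ?_)
    intro a ha b hb
    have hb' : b = v ∨ b ∈ W₁ := by grind
    obtain rfl | hb := hb'
    · exact ⟨hv₂ a ha, fun hadj ↦ hz a ha hadj.symm⟩
    · exact (h hb ha).symm

theorem IsCographOn.isJoinOn_insert {v : V} (hv : v ∉ W) (hG : IsCographOn G (insert v W))
    (hW : IsJoinOn Gᶜ W) : IsJoinOn G (insert v W) ∨ IsJoinOn Gᶜ (insert v W) := by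
  obtain ⟨W₁, W₂, h₁, h₂, h, rfl⟩ := hW
  obtain hv₁ | hjoin := hG.adj_or_isJoinOn_compl_insert hv h₂ h
  · rw [union_comm] at hv hG ⊢
    obtain hv₂ | hjoin := hG.adj_or_isJoinOn_compl_insert hv h₁ h.symm
    · refine .inl (isJoinOn_of_subset (U := {v}) (singleton_nonempty v)
        ⟨by simp, fun hsub ↦ ?_⟩ ?_)
      · obtain ⟨a, ha⟩ := h₁
        have hav : a = v := mem_singleton.1 (hsub (by simp [ha]))
        exact hv (hav ▸ mem_union_right W₂ ha)
      · grind
    · exact .inr hjoin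
  · exact .inr hjoin

/-- Seinsche's theorem: a cograph on at least two vertices is disconnected, or its complement is. -/
theorem IsCographOn.isJoinOn_or_isJoinOn_compl (hG : IsCographOn G W) (hW : W.Nontrivial) :
    IsJoinOn G W ∨ IsJoinOn Gᶜ W := by
  induction W using Finset.induction_on with
  | empty => simp at hW
  | insert v U hv ih =>
    obtain rfl | hU := U.eq_empty_or_nonempty
    · simp at hW
    obtain ⟨u, rfl⟩ | hU := hU.exists_eq_singleton_or_nontrivial
    · have hvu : v ≠ u := by simpa using hv
      by_cases hadj : G.Adj v u
      · exact .inl ⟨{v}, {u}, by simp, by simp, by simpa [SimpleGraph.IsCompleteBetween], rfl⟩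
      · exact .inr ⟨{v}, {u}, by simp, by simp, by simp [SimpleGraph.IsCompleteBetween, *], rfl⟩
    · obtain h | h := ih (hG.mono (subset_insert v U)) hU
      · rw [← compl_compl G] at h
        simpa only [compl_compl, or_comm] using hG.compl.isJoinOn_insert hv h
      · exact hG.isJoinOn_insert hv h

theorem IsCographOn.induction {motive : Finset V → Prop} (singleton : ∀ v, motive {v})
    (join : ∀ W₁ W₂ : Finset V, W₁.Nonempty → W₂.Nonempty → G.IsCompleteBetween W₁ W₂ →
      motive W₁ → motive W₂ → motive (W₁ ∪ W₂))
    (union : ∀ W₁ W₂ : Finset V, W₁.Nonempty → W₂.Nonempty → Gᶜ.IsCompleteBetween W₁ W₂ →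
      motive W₁ → motive W₂ → motive (W₁ ∪ W₂))
    (hG : IsCographOn G W) (hW : W.Nonempty) : motive W := by
  induction W using Finset.strongInduction with
  | H W ih =>
    have motive_parts (H : SimpleGraph V) (W₁ W₂ : Finset V) (h₁ : W₁.Nonempty)
        (h₂ : W₂.Nonempty) (h : H.IsCompleteBetween W₁ W₂) (hunion : W = W₁ ∪ W₂) :
        motive W₁ ∧ motive W₂ := by
      subst hunion
      have hdisj : Disjoint W₁ W₂ := disjoint_coe.1 h.disjoint
      exact ⟨ih W₁ (Finset.ssubset_iff_subset_ne.2 ⟨subset_union_left, fun heq ↦ h₂.ne_empty <|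
          hdisj.eq_bot_of_ge <| heq ▸ subset_union_right⟩) (hG.mono subset_union_left) h₁,
        ih W₂ (Finset.ssubset_iff_subset_ne.2 ⟨subset_union_right, fun heq ↦ h₁.ne_empty <|
          hdisj.eq_bot_of_le <| heq ▸ subset_union_left⟩) (hG.mono subset_union_right) h₂⟩
    obtain ⟨v, rfl⟩ | hW' := hW.exists_eq_singleton_or_nontrivial
    · exact singleton v
    obtain ⟨W₁, W₂, h₁, h₂, h, hunion⟩ | ⟨W₁, W₂, h₁, h₂, h, hunion⟩ :=
      hG.isJoinOn_or_isJoinOn_compl hW'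
    all_goals obtain ⟨hm₁, hm₂⟩ := motive_parts _ W₁ W₂ h₁ h₂ h hunion
    · exact hunion ▸ join W₁ W₂ h₁ h₂ h hm₁ hm₂
    · exact hunion ▸ union W₁ W₂ h₁ h₂ h hm₁ hm₂

end Decomposition

open Classical in
/-- The maximal cliques of the subgraph of `G` induced by `W`. Maximal independent sets are
obtained as `maximalCliques Gᶜ W`. -/
noncomputable def maximalCliques (G : SimpleGraph V) (W : Finset V) : Finset (Finset V) :=
  {K ∈ W.powerset | Maximal (fun L : Finset V ↦ L ⊆ W ∧ G.IsClique L) K}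

theorem mem_maximalCliques : K ∈ maximalCliques G W ↔
    K ⊆ W ∧ ∀ v ∈ W, v ∈ K ↔ ∀ a ∈ K, v ≠ a → G.Adj v a := by
  classical
  rw [maximalCliques, mem_filter, mem_powerset]
  constructor
  · rintro ⟨-, ⟨hKW, hK⟩, hmax⟩
    refine ⟨hKW, fun v hv ↦ ⟨fun hvK a ha ↦ hK hvK ha, fun hadj ↦ ?_⟩⟩
    exact hmax ⟨insert_subset hv hKW, by simpa using hK.insert hadj⟩ (subset_insert v K)
      (mem_insert_self v K)
  · rintro ⟨hKW, hK⟩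
    exact ⟨hKW, ⟨hKW, fun v hv a ha ↦ (hK v (hKW hv)).1 hv a ha⟩, fun L hL hKL v hv ↦
      (hK v (hL.1 hv)).2 fun a ha ↦ hL.2 hv (hKL ha)⟩

theorem nonempty_of_mem_maximalCliques (hK : K ∈ maximalCliques G W) (hW : W.Nonempty) :
    K.Nonempty := by
  rw [nonempty_iff_ne_empty]
  rintro rfl
  obtain ⟨w, hw⟩ := hW
  simpa using (mem_maximalCliques.1 hK).2 w hw

/-- Along a maximal independent set `I`, the neighbourhoods of the vertices of a clique form a
chain, because two incomparable ones span an induced path. If the clique is maximal and misses `I`,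
then a vertex of `I` in the smallest neighbourhood extends the clique. -/
theorem IsCographOn.exists_mem_clique_mem_indep (hG : IsCographOn G W) (hW : W.Nonempty)
    {I : Finset V} (hK : K ∈ maximalCliques G W) (hI : I ∈ maximalCliques Gᶜ W) :
    ∃ v ∈ K, v ∈ I := by
  by_contra! hKI
  have hKn := nonempty_of_mem_maximalCliques hK hW
  rw [mem_maximalCliques] at hK hI
  obtain ⟨⟨hKW, hK⟩, hIW, hI⟩ := And.intro hK hI
  have hne : ∀ u ∈ K, ∀ x ∈ I, u ≠ x := fun u hu x hx hux ↦ hKI u hu (hux ▸ hx)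
  classical
  obtain ⟨v, hv, hvmin⟩ := exists_min_image K (fun u ↦ #{x ∈ I | G.Adj u x}) hKn
  obtain ⟨x, hx, hvx⟩ : ∃ x ∈ I, G.Adj v x := by
    by_contra! hnot
    exact hKI v hv <| (hI v (hKW hv)).2 fun a ha hva ↦ ⟨hva, hnot a ha⟩
  refine hKI x ((hK x (hIW hx)).2 fun u hu _ ↦ ?_) hx
  by_contra hxu
  have hux : ¬ G.Adj u x := fun h ↦ hxu h.symm
  obtain ⟨y, hy, huy, hvy⟩ : ∃ y ∈ I, G.Adj u y ∧ ¬ G.Adj v y := by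
    by_contra! hsub
    refine (hvmin u hu).not_gt (card_lt_card (ssubset_iff_of_subset ?_ |>.2 ⟨x, ?_, ?_⟩))
    · exact fun y hy ↦ by simp_all
    · simp [hx, hvx]
    · simp [hux]
  have huv : v ≠ u := fun h ↦ hux (h ▸ hvx)
  have hxy : x ≠ y := fun h ↦ hvy (h ▸ hvx)
  exact ((hI x (hIW hx)).1 hx y hy hxy).2 <| hG x (hIW hx) v (hKW hv) u (hKW hu) y (hIW hy)
    hvx.symm ((hK v (hKW hv)).1 hv u hu huv) huy ⟨(hne u hu x hx).symm, hxu⟩ ⟨hne v hv y hy, hvy⟩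

theorem maximalCliques_singleton (G : SimpleGraph V) (v : V) :
    maximalCliques G {v} = {{v}} := by
  ext K
  rw [mem_maximalCliques, mem_singleton]
  constructor
  · rintro ⟨hK, hmax⟩
    grind
  · rintro rfl
    simp

/-- There are at least as many maximal independent sets in `W` as vertices. In the case of equality,
the maximal cliques of `W` have the size they have in a join of `a` copies of two disjoint edges and
`b` single vertices. -/
def IndepSetBound (G : SimpleGraph V) (W : Finset V) : Prop :=
  #W ≤ #(maximalCliques Gᶜ W) ∧ (#W = #(maximalCliques Gᶜ W) →
    ∀ K ∈ maximalCliques G W, ∃ a b, #W = 4 * a + b ∧ #K = 2 * a + b)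

theorem indepSetBound_singleton (G : SimpleGraph V) (v : V) : IndepSetBound G {v} := by
  simp only [IndepSetBound, maximalCliques_singleton, card_singleton, le_refl, mem_singleton,
    forall_eq, true_and]
  exact fun _ ↦ ⟨0, 1, rfl, rfl⟩

section Parts

variable [DecidableEq V]

theorem mem_maximalCliques_union_left (h : Gᶜ.IsCompleteBetween W₁ W₂) (hK : K ⊆ W₁)
    (hKn : K.Nonempty) : K ∈ maximalCliques G (W₁ ∪ W₂) ↔ K ∈ maximalCliques G W₁ := by
  obtain ⟨a, ha⟩ := hKn
  have hW₂ : ∀ w ∈ W₂, w ≠ a ∧ ¬ G.Adj w a := fun w hw ↦ (h (hK ha) hw).symm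
  grind [mem_maximalCliques]

theorem maximalCliques_union (h : Gᶜ.IsCompleteBetween W₁ W₂) (h₁ : W₁.Nonempty)
    (h₂ : W₂.Nonempty) :
    maximalCliques G (W₁ ∪ W₂) = maximalCliques G W₁ ∪ maximalCliques G W₂ := by
  ext K
  rw [mem_union]
  constructor
  · intro hK
    have hKn := nonempty_of_mem_maximalCliques hK h₁.inl
    by_cases hK₁ : K ⊆ W₁
    · exact .inl ((mem_maximalCliques_union_left h hK₁ hKn).1 hK)
    · obtain ⟨hKW, hKc⟩ := mem_maximalCliques.1 hK
      obtain ⟨b, hb, hb₁⟩ := not_subset.1 hK₁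
      have hb₂ : b ∈ W₂ := (mem_union.1 (hKW hb)).resolve_left hb₁
      have hK₂ : K ⊆ W₂ := fun a ha ↦ (mem_union.1 (hKW ha)).resolve_left fun ha₁ ↦
        (h ha₁ hb₂).2 ((hKc a (hKW ha)).1 ha b hb (h ha₁ hb₂).1)
      exact .inr ((mem_maximalCliques_union_left h.symm hK₂ hKn).1 (union_comm W₁ W₂ ▸ hK))
  · rintro (hK | hK)
    · exact (mem_maximalCliques_union_left h (mem_maximalCliques.1 hK).1
        (nonempty_of_mem_maximalCliques hK h₁)).2 hK
    · exact union_comm W₁ W₂ ▸ (mem_maximalCliques_union_left h.symm (mem_maximalCliques.1 hK).1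
        (nonempty_of_mem_maximalCliques hK h₂)).2 hK

theorem card_maximalCliques_union (h : Gᶜ.IsCompleteBetween W₁ W₂) (h₁ : W₁.Nonempty)
    (h₂ : W₂.Nonempty) :
    #(maximalCliques G (W₁ ∪ W₂)) = #(maximalCliques G W₁) + #(maximalCliques G W₂) := by
  rw [maximalCliques_union h h₁ h₂, card_union_of_disjoint]
  rw [Finset.disjoint_left]
  intro K hK₁ hK₂
  obtain ⟨a, ha⟩ := nonempty_of_mem_maximalCliques hK₁ h₁
  exact disjoint_left.1 (disjoint_coe.1 h.disjoint) ((mem_maximalCliques.1 hK₁).1 ha)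
    ((mem_maximalCliques.1 hK₂).1 ha)

theorem maximalCliques_join (h : G.IsCompleteBetween W₁ W₂) :
    maximalCliques G (W₁ ∪ W₂) =
      image₂ (· ∪ ·) (maximalCliques G W₁) (maximalCliques G W₂) := by
  have hadj : ∀ a ∈ W₁, ∀ b ∈ W₂, G.Adj a b ∧ G.Adj b a := fun a ha b hb ↦
    ⟨h ha hb, (h ha hb).symm⟩
  ext K
  rw [mem_image₂]
  constructor
  · intro hK
    refine ⟨K ∩ W₁, ?_, K ∩ W₂, ?_, ?_⟩ <;> grind [mem_maximalCliques]
  · rintro ⟨K₁, hK₁, K₂, hK₂, rfl⟩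
    grind [mem_maximalCliques]

theorem card_maximalCliques_join (h : G.IsCompleteBetween W₁ W₂) :
    #(maximalCliques G (W₁ ∪ W₂)) = #(maximalCliques G W₁) * #(maximalCliques G W₂) := by
  have hdisj : Disjoint W₁ W₂ := disjoint_coe.1 h.disjoint
  rw [maximalCliques_join h, card_image₂_iff.2]
  have recover (K₁ K₂ : Finset V) (h₁ : K₁ ⊆ W₁) (h₂ : K₂ ⊆ W₂) :
      (K₁ ∪ K₂) ∩ W₁ = K₁ ∧ (K₁ ∪ K₂) ∩ W₂ = K₂ := by
    grind [Finset.disjoint_left]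
  rintro ⟨K₁, K₂⟩ ⟨hK₁, hK₂⟩ ⟨L₁, L₂⟩ ⟨hL₁, hL₂⟩ (heq : K₁ ∪ K₂ = L₁ ∪ L₂)
  obtain ⟨hK₁, hK₂⟩ := recover K₁ K₂ (mem_maximalCliques.1 hK₁).1 (mem_maximalCliques.1 hK₂).1
  obtain ⟨hL₁, hL₂⟩ := recover L₁ L₂ (mem_maximalCliques.1 hL₁).1 (mem_maximalCliques.1 hL₂).1
  exact Prod.ext (hK₁.symm.trans <| (congrArg (· ∩ W₁) heq).trans hL₁)
    (hK₂.symm.trans <| (congrArg (· ∩ W₂) heq).trans hL₂)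

/-- No vertex of `W` has its neighbourhood in `W` contained in that of another one. -/
def NoDomination (G : SimpleGraph V) (W : Finset V) : Prop :=
  ∀ a ∈ W, ∀ b ∈ W, (∀ c ∈ W, G.Adj a c → G.Adj b c) → a = b

theorem NoDomination.of_union (h : NoDomination G (W₁ ∪ W₂))
    (h₁₂ : ∀ a ∈ W₁, ∀ b ∈ W₁, ∀ c ∈ W₂, G.Adj a c → G.Adj b c) : NoDomination G W₁ :=
  fun a ha b hb hab ↦ h a (mem_union_left W₂ ha) b (mem_union_left W₂ hb) fun c hc hac ↦
    (mem_union.1 hc).elim (fun hc ↦ hab c hc hac) (fun hc ↦ h₁₂ a ha b hb c hc hac)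

theorem NoDomination.of_join (h : NoDomination G (W₁ ∪ W₂)) (hG : G.IsCompleteBetween W₁ W₂) :
    NoDomination G W₁ ∧ NoDomination G W₂ :=
  ⟨h.of_union fun _ _ _ hb _ hc _ ↦ hG hb hc,
    (union_comm W₁ W₂ ▸ h).of_union fun _ _ _ hb _ hc _ ↦ (hG hc hb).symm⟩

theorem NoDomination.of_compl_join (h : NoDomination G (W₁ ∪ W₂))
    (hG : Gᶜ.IsCompleteBetween W₁ W₂) : NoDomination G W₁ ∧ NoDomination G W₂ :=
  ⟨h.of_union fun _ ha _ _ _ hc hac ↦ ((hG ha hc).2 hac).elim,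
    (union_comm W₁ W₂ ▸ h).of_union fun _ ha _ _ _ hc hac ↦ ((hG hc ha).2 hac.symm).elim⟩

theorem NoDomination.two_le_card_left (h : NoDomination G (W₁ ∪ W₂))
    (hG : Gᶜ.IsCompleteBetween W₁ W₂) (h₁ : W₁.Nonempty) (h₂ : W₂.Nonempty) : 2 ≤ #W₁ := by
  obtain ⟨a, rfl⟩ | hW₁ := h₁.exists_eq_singleton_or_nontrivial
  · obtain ⟨b, hb⟩ := h₂
    have hab : Gᶜ.Adj a b := hG (by simp) hb
    refine (hab.1 (h a (by simp) b (by simp [hb]) fun c hc hac ↦ ?_)).elim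
    obtain rfl | hc := by simpa using hc
    · exact (G.loopless.irrefl c hac).elim
    · exact ((hG (by simp) hc).2 hac).elim
  · exact one_lt_card_iff_nontrivial.2 hW₁

theorem IndepSetBound.join (hG : G.IsCompleteBetween W₁ W₂) (h₁ : W₁.Nonempty) (h₂ : W₂.Nonempty)
    (hW₁ : IndepSetBound G W₁) (hW₂ : IndepSetBound G W₂) : IndepSetBound G (W₁ ∪ W₂) := by
  obtain ⟨hle₁, heq₁⟩ := hW₁
  obtain ⟨hle₂, heq₂⟩ := hW₂
  have hdisj : Disjoint W₁ W₂ := disjoint_coe.1 hG.disjoint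
  rw [IndepSetBound, card_union_of_disjoint hdisj,
    card_maximalCliques_union (by rwa [compl_compl]) h₁ h₂, maximalCliques_join hG]
  refine ⟨add_le_add hle₁ hle₂, fun heq K hK ↦ ?_⟩
  obtain ⟨K₁, hK₁, K₂, hK₂, rfl⟩ := mem_image₂.1 hK
  obtain ⟨a₁, b₁, hW₁, hK₁'⟩ := heq₁ (by lia) K₁ hK₁
  obtain ⟨a₂, b₂, hW₂, hK₂'⟩ := heq₂ (by lia) K₂ hK₂
  have hdisjK : Disjoint K₁ K₂ :=
    hdisj.mono (mem_maximalCliques.1 hK₁).1 (mem_maximalCliques.1 hK₂).1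
  refine ⟨a₁ + a₂, b₁ + b₂, by lia, ?_⟩
  rw [card_union_of_disjoint hdisjK]
  lia

theorem IndepSetBound.union (hG : Gᶜ.IsCompleteBetween W₁ W₂) (h₁ : 2 ≤ #W₁) (h₂ : 2 ≤ #W₂)
    (hW₁ : IndepSetBound G W₁) (hW₂ : IndepSetBound G W₂) : IndepSetBound G (W₁ ∪ W₂) := by
  obtain ⟨hle₁, heq₁⟩ := hW₁
  obtain ⟨hle₂, heq₂⟩ := hW₂
  rw [IndepSetBound, card_union_of_disjoint (disjoint_coe.1 hG.disjoint),
    card_maximalCliques_join hG, maximalCliques_union hG (card_pos.1 (by lia))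
      (card_pos.1 (by lia))]
  have hmul := Nat.mul_le_mul hle₁ hle₂
  have hadd : #W₁ + #W₂ ≤ #W₁ * #W₂ := by nlinarith
  refine ⟨hadd.trans hmul, fun heq K hK ↦ ⟨1, 0, ?_⟩⟩
  have hW₁ : #W₁ = 2 := by nlinarith
  have hW₂ : #W₂ = 2 := by nlinarith
  have hI₁ : #W₁ = #(maximalCliques Gᶜ W₁) := by nlinarith
  have hI₂ : #W₂ = #(maximalCliques Gᶜ W₂) := by nlinarith
  refine ⟨by lia, ?_⟩
  obtain hK | hK := mem_union.1 hK
  · obtain ⟨a, b, hab, hKab⟩ := heq₁ hI₁ K hK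
    lia
  · obtain ⟨a, b, hab, hKab⟩ := heq₂ hI₂ K hK
    lia

end Parts

theorem IsCographOn.indepSetBound (hG : IsCographOn G W) (hW : W.Nonempty)
    (hdom : NoDomination G W) : IndepSetBound G W := by
  classical
  refine IsCographOn.induction (motive := fun W ↦ NoDomination G W → IndepSetBound G W)
    (fun v _ ↦ indepSetBound_singleton G v) ?join ?union hG hW hdom
  case join =>
    intro W₁ W₂ h₁ h₂ h ih₁ ih₂ hdom
    exact .join h h₁ h₂ (ih₁ (hdom.of_join h).1) (ih₂ (hdom.of_join h).2)
  case union =>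
    intro W₁ W₂ h₁ h₂ h ih₁ ih₂ hdom
    exact .union h (hdom.two_le_card_left h h₁ h₂)
      ((union_comm W₁ W₂ ▸ hdom).two_le_card_left h.symm h₂ h₁)
      (ih₁ (hdom.of_compl_join h).1) (ih₂ (hdom.of_compl_join h).2)

end Cograph

section PartitionEfficient

open Finset

variable {α : Type*} [Fintype α] [DecidableEq α] {F : Finset (Finset α)}
  {P Q : Finpartition (univ : Finset α)}

/-- Every subfamily of `F` covering the ground set contains a partition of it. For families of
`k`-sets on `q * k` points this is the same as being union-`q`-efficient. -/
def PartitionEfficient (F : Finset (Finset α)) : Prop :=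
  ∀ S ⊆ F, S.sup id = univ → ∃ P : Finpartition (univ : Finset α), P.parts ⊆ S

theorem PartitionEfficient.exists_exchange (hF : PartitionEfficient F) (hP : P.parts ⊆ F)
    (hQ : Q.parts ⊆ F) {x y : α} (hxy : Disjoint (P.part x) (Q.part y)) :
    ∃ R : Finpartition univ, R.parts ⊆ F ∧ R.part x = Q.part x ∧ R.part y = P.part y := by
  have hcover : (P.parts.erase (P.part x) ∪ Q.parts.erase (Q.part y)).sup id = univ := by
    refine eq_univ_of_forall fun z ↦ ?_
    have hzP : z ∈ P.part z := P.mem_part (mem_univ z)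
    have hzQ : z ∈ Q.part z := Q.mem_part (mem_univ z)
    have hz : P.part z ≠ P.part x ∨ Q.part z ≠ Q.part y := by
      by_contra! h
      exact disjoint_left.1 hxy (h.1 ▸ hzP) (h.2 ▸ hzQ)
    rw [mem_sup]
    obtain hz | hz := hz
    · exact ⟨P.part z, mem_union_left _ (by simp [hz]), hzP⟩
    · exact ⟨Q.part z, mem_union_right _ (by simp [hz]), hzQ⟩
  obtain ⟨R, hR⟩ := hF _ (union_subset ((erase_subset _ _).trans hP)
    ((erase_subset _ _).trans hQ)) hcover
  have part_mem (z : α) : (R.part z ≠ P.part x ∧ R.part z = P.part z) ∨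
      (R.part z ≠ Q.part y ∧ R.part z = Q.part z) := by
    have hz : z ∈ R.part z := R.mem_part (mem_univ z)
    obtain h | h := mem_union.1 (hR (R.part_mem.2 (mem_univ z))) <;> rw [mem_erase] at h
    · exact .inl ⟨h.1, (P.part_eq_of_mem h.2 hz).symm⟩
    · exact .inr ⟨h.1, (Q.part_eq_of_mem h.2 hz).symm⟩
  exact ⟨R, hR.trans (union_subset ((erase_subset _ _).trans hP) ((erase_subset _ _).trans hQ)),
    by grind, by grind⟩

theorem PartitionEfficient.exists_common_partition (hF : PartitionEfficient F) (hP : P.parts ⊆ F)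
    (hQ : Q.parts ⊆ F) {x y : α} (hxy : Disjoint (P.part x) (Q.part y)) :
    ∃ R : Finpartition univ, R.parts ⊆ F ∧ R.part x = P.part x ∧ R.part y = Q.part y := by
  obtain ⟨R, hR, hRx, hRy⟩ := hF.exists_exchange hP hQ hxy
  have hne : R.part x ≠ R.part y := by
    intro heq
    rw [hRx, hRy] at heq
    have hPxy := (P.mem_part_iff_part_eq_part (mem_univ x) (mem_univ y)).1 <|
      heq ▸ Q.mem_part (mem_univ x)
    have hQxy := (Q.mem_part_iff_part_eq_part (mem_univ y) (mem_univ x)).1 <|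
      heq ▸ P.mem_part (mem_univ y)
    rw [hPxy, hQxy, heq, disjoint_self] at hxy
    exact P.ne_bot (P.part_mem.2 (mem_univ y)) hxy
  refine hF.exists_exchange hQ hP ?_
  rw [← hRx, ← hRy]
  exact R.disjoint (R.part_mem.2 (mem_univ x)) (R.part_mem.2 (mem_univ y)) hne

open Classical in
/-- The members of `F` that occur in some partition of the ground set into members of `F`. -/
noncomputable def essentialPart (F : Finset (Finset α)) : Finset (Finset α) :=
  {A ∈ F | ∃ P : Finpartition (univ : Finset α), P.parts ⊆ F ∧ A ∈ P.parts}

theorem essentialPart_subset (F : Finset (Finset α)) : essentialPart F ⊆ F :=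
  filter_subset _ F

theorem mem_essentialPart {A : Finset α} : A ∈ essentialPart F ↔
    ∃ P : Finpartition (univ : Finset α), P.parts ⊆ F ∧ A ∈ P.parts := by
  rw [essentialPart, mem_filter, and_iff_right_iff_imp]
  exact fun ⟨_, hP, hA⟩ ↦ hP hA

theorem parts_subset_essentialPart (hP : P.parts ⊆ F) : P.parts ⊆ essentialPart F :=
  fun _ hA ↦ mem_essentialPart.2 ⟨P, hP, hA⟩

/-- The graph on all subsets of `α` in which distinct disjoint sets are adjacent. -/
def disjointnessGraph (α : Type*) : SimpleGraph (Finset α) where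
  Adj A B := A ≠ B ∧ Disjoint A B
  symm.symm _ _ h := ⟨h.1.symm, h.2.symm⟩

theorem PartitionEfficient.isCographOn (hF : PartitionEfficient F) :
    IsCographOn (disjointnessGraph α) (essentialPart F) := by
  have exists_partition : ∀ A ∈ essentialPart F, ∀ B ∈ essentialPart F, Disjoint A B →
      ∃ P : Finpartition univ, P.parts ⊆ F ∧ A ∈ P.parts ∧ B ∈ P.parts := by
    intro A hA B hB hAB
    obtain ⟨⟨P, hP, hA⟩, Q, hQ, hB⟩ := And.intro (mem_essentialPart.1 hA) (mem_essentialPart.1 hB)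
    obtain ⟨x, hx⟩ := P.nonempty_of_mem_parts hA
    obtain ⟨y, hy⟩ := Q.nonempty_of_mem_parts hB
    obtain rfl := P.part_eq_of_mem hA hx
    obtain rfl := Q.part_eq_of_mem hB hy
    obtain ⟨R, hR, hRx, hRy⟩ := hF.exists_common_partition hP hQ hAB
    exact ⟨R, hR, hRx ▸ R.part_mem.2 (mem_univ x), hRy ▸ R.part_mem.2 (mem_univ y)⟩
  intro A hA B hB C hC D hD hAB hBC hCD hAC hBD
  obtain ⟨x, hxA, hxC⟩ := not_disjoint_iff.1 fun h ↦ hAC.2 ⟨hAC.1, h⟩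
  obtain ⟨y, hyB, hyD⟩ := not_disjoint_iff.1 fun h ↦ hBD.2 ⟨hBD.1, h⟩
  obtain ⟨P, hP, hAP, hBP⟩ := exists_partition A hA B hB hAB.2
  obtain ⟨Q, hQ, hCQ, hDQ⟩ := exists_partition C hC D hD hCD.2
  obtain ⟨R, -, hRy, hRx⟩ := hF.exists_exchange hP hQ (x := y) (y := x)
    (by rw [P.part_eq_of_mem hBP hyB, Q.part_eq_of_mem hCQ hxC]; exact hBC.2)
  rw [Q.part_eq_of_mem hDQ hyD] at hRy
  rw [P.part_eq_of_mem hAP hxA] at hRx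
  have hAD : A ≠ D := fun h ↦ disjoint_left.1 hCD.2 hxC (h ▸ hxA)
  exact ⟨hAD, R.disjoint (hRx ▸ R.part_mem.2 (mem_univ x)) (hRy ▸ R.part_mem.2 (mem_univ y)) hAD⟩

theorem parts_mem_maximalCliques (hP : P.parts ⊆ F) :
    P.parts ∈ maximalCliques (disjointnessGraph α) (essentialPart F) := by
  refine mem_maximalCliques.2 ⟨parts_subset_essentialPart hP, fun A hA ↦ ⟨fun hAP B hB hAB ↦
    ⟨hAB, P.disjoint hAP hB hAB⟩, fun hadj ↦ ?_⟩⟩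
  obtain ⟨Q, -, hAQ⟩ := mem_essentialPart.1 hA
  obtain ⟨x, hx⟩ := Q.nonempty_of_mem_parts hAQ
  by_contra hAP
  have hxP : P.part x ∈ P.parts := P.part_mem.2 (mem_univ x)
  exact disjoint_left.1 (hadj _ hxP fun h ↦ hAP (h ▸ hxP)).2 hx (P.mem_part (mem_univ x))

theorem noDomination_essentialPart (hF : IsAntichain (· ⊆ ·) (F : Set (Finset α))) :
    NoDomination (disjointnessGraph α) (essentialPart F) := by
  intro A hA B hB hAB
  obtain ⟨P, hP, hAP⟩ := mem_essentialPart.1 hA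
  refine (hF.eq (essentialPart_subset F hB) (hP hAP) fun x hx ↦ ?_).symm
  have hxP : P.part x ∈ P.parts := P.part_mem.2 (mem_univ x)
  by_contra hxA
  have hne : A ≠ P.part x := fun h ↦ hxA (h ▸ P.mem_part (mem_univ x))
  exact disjoint_left.1 (hAB _ (parts_subset_essentialPart hP hxP)
    ⟨hne, P.disjoint hAP hxP hne⟩).2 hx (P.mem_part (mem_univ x))

/-- If the members of `F` outside `I` covered the ground set, then they would contain a partition,
which is a maximal clique and so has to meet `I`. -/
theorem PartitionEfficient.exists_point [Nonempty α] (hF : PartitionEfficient F)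
    {I : Finset (Finset α)} (hI : I ∈ maximalCliques (disjointnessGraph α)ᶜ (essentialPart F)) :
    ∃ x, {A ∈ F | x ∈ A} = I := by
  have hmeet (P : Finpartition univ) (hP : P.parts ⊆ F) : ∃ A ∈ P.parts, A ∈ I :=
    hF.isCographOn.exists_mem_clique_mem_indep
      ((P.parts_nonempty univ_nonempty.ne_empty).mono (parts_subset_essentialPart hP))
      (parts_mem_maximalCliques hP) hI
  obtain ⟨hIF, hI⟩ := mem_maximalCliques.1 hI
  obtain ⟨x, hx⟩ : ∃ x, x ∉ (F \ I).sup id := by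
    by_contra! hcover
    obtain ⟨P, hP⟩ := hF _ sdiff_subset (eq_univ_of_forall hcover)
    obtain ⟨A, hA, hAI⟩ := hmeet P (hP.trans sdiff_subset)
    exact (mem_sdiff.1 (hP hA)).2 hAI
  have mem_I : ∀ A ∈ F, x ∈ A → A ∈ I := by
    intro A hA hxA
    by_contra hAI
    exact hx (mem_sup.2 ⟨A, mem_sdiff.2 ⟨hA, hAI⟩, hxA⟩)
  refine ⟨x, Subset.antisymm (fun A hA ↦ mem_I A (mem_filter.1 hA).1 (mem_filter.1 hA).2)
    fun A hA ↦ mem_filter.2 ⟨essentialPart_subset F (hIF hA), ?_⟩⟩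
  obtain ⟨P, hP, hAP⟩ := mem_essentialPart.1 (hIF hA)
  have hxP : P.part x ∈ P.parts := P.part_mem.2 (mem_univ x)
  have hxI : P.part x ∈ I := mem_I _ (hP hxP) (P.mem_part (mem_univ x))
  by_contra hxA
  have hne : A ≠ P.part x := fun h ↦ hxA (h ▸ P.mem_part (mem_univ x))
  exact ((hI A (hIF hA)).1 hA _ hxI hne).2 ⟨hne, P.disjoint hAP hxP hne⟩

theorem PartitionEfficient.exists_points [Nonempty α] (hF : PartitionEfficient F) :
    ∃ X : Finset α, #X = #(maximalCliques (disjointnessGraph α)ᶜ (essentialPart F)) ∧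
      Set.InjOn (fun x ↦ ({A ∈ F | x ∈ A} : Finset (Finset α))) X ∧
      ∀ x ∈ X, ∀ A ∈ F, x ∈ A → A ∈ essentialPart F := by
  obtain ⟨X, -, hinj, hX⟩ := exists_subset_injOn_image_eq_of_surjOn Set.univ
    (maximalCliques (disjointnessGraph α)ᶜ (essentialPart F))
    (f := fun x ↦ ({A ∈ F | x ∈ A} : Finset (Finset α)))
    fun I hI ↦ (hF.exists_point hI).imp fun x hx ↦ ⟨Set.mem_univ x, hx⟩
  refine ⟨X, by rw [← hX, card_image_of_injOn hinj], hinj, fun x hx A hA hxA ↦ ?_⟩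
  have hI := mem_maximalCliques.1 (hX ▸ mem_image_of_mem _ hx)
  exact hI.1 (mem_filter.2 ⟨hA, hxA⟩)

end PartitionEfficient

section Choose

variable {i j k q m : ℕ}

theorem add_choose_lt_add_choose (hk : 2 ≤ k) (hki : k ≤ i) (hij : i < j) :
    j + i.choose k < i + j.choose k := by
  have step (m : ℕ) (hm : k ≤ m) : m + 1 + m.choose k < m + (m + 1).choose k := by
    obtain ⟨k, rfl⟩ := Nat.exists_eq_add_one.2 (zero_lt_two.trans_le hk)
    have hle := Nat.choose_le_choose k hm
    rw [Nat.choose_succ_self_right] at hle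
    rw [Nat.choose_succ_succ']
    lia
  induction j, hij using Nat.le_induction with
  | base => exact step i hki
  | succ j hij ih => have := step j (by lia); lia

theorem le_choose (hk : 2 ≤ k) (hkj : k + 1 ≤ j) :
    j ≤ j.choose k ∧ (j = j.choose k → j = k + 1) := by
  obtain rfl | hkj := hkj.eq_or_lt
  · simp
  · have := add_choose_lt_add_choose hk k.le_succ hkj
    rw [Nat.choose_succ_self_right] at this
    lia

theorem add_choose_le (hq : 2 ≤ q) (hk : 2 ≤ k) (hqk : (q, k) ≠ (2, 2)) (hqm : q ≤ m)
    (hm : m ≤ q * k) :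
    m + (q * k - m).choose k ≤ q + (q * k - q).choose k ∧
      (m + (q * k - m).choose k = q + (q * k - q).choose k →
        m = q ∨ m = q * k ∧ (q = 2 ∨ q = 3)) := by
  by_cases hkm : k ≤ q * k - m
  · obtain rfl | hqm := hqm.eq_or_lt
    · simp
    · have := add_choose_lt_add_choose hk hkm (show q * k - m < q * k - q by lia)
      lia
  · have hmul : q * k - q = (q - 1) * (k - 1) + k - 1 := by
      obtain ⟨a, rfl⟩ := Nat.exists_eq_add_of_le hq
      obtain ⟨b, rfl⟩ := Nat.exists_eq_add_of_le hk
      grind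
    have hqk' : 2 ≤ (q - 1) * (k - 1) := by
      obtain hq | hq := hq.eq_or_lt
      · grind
      · exact Nat.mul_le_mul (show 2 ≤ q - 1 by lia) (show 1 ≤ k - 1 by lia)
    obtain ⟨hle, heq⟩ := le_choose hk (show k + 1 ≤ q * k - q by lia)
    rw [Nat.choose_eq_zero_of_lt (not_le.1 hkm)]
    refine ⟨by lia, fun h ↦ .inr ⟨by lia, ?_⟩⟩
    have hdvd : q - 1 ∣ 2 := Dvd.intro (k - 1) (by lia)
    have := Nat.le_of_dvd two_pos hdvd
    lia

end Choose

section Transversal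

open Finset

theorem card_filter_decide_mem {α : Type*} [DecidableEq α] {A X : Finset α} {k : ℕ} (hA : #A = k)
    (hXA : #(X ∩ A) = 1) (b : Bool) :
    #{x ∈ A | decide (x ∈ X) = b} = if b then 1 else k - 1 := by
  have hsplit := card_filter_add_card_filter_not (s := A) (· ∈ X)
  rw [filter_mem_eq_inter, inter_comm, hXA, hA] at hsplit
  cases b
  · simp only [decide_eq_false_iff_not, Bool.false_eq_true, if_false]
    lia
  · simpa [filter_mem_eq_inter, inter_comm] using hXA

variable {α : Type*} [Fintype α] [DecidableEq α] {F S : Finset (Finset α)} {X : Finset α}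
  {P : Finpartition (univ : Finset α)} {q k : ℕ}

/-- `X` contains exactly one element of each part of `P`. -/
def IsTransversal (P : Finpartition (univ : Finset α)) (X : Finset α) : Prop :=
  ∀ A ∈ P.parts, #(X ∩ A) = 1

/-- The parts of `P`, together with all `k`-sets that avoid `X`. The extremal families are those in
which `X` is a transversal of `P`. -/
def transversalFamily (P : Finpartition (univ : Finset α)) (X : Finset α) (k : ℕ) :
    Finset (Finset α) :=
  P.parts ∪ powersetCard k Xᶜ

theorem transversalFamily_subset_powersetCard (hP : P.parts ⊆ powersetCard k univ) :
    transversalFamily P X k ⊆ powersetCard k univ :=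
  union_subset hP (powersetCard_mono (subset_univ _))

theorem sum_card_inter_parts (P : Finpartition (univ : Finset α)) (X : Finset α) :
    ∑ A ∈ P.parts, #(X ∩ A) = #X := by
  rw [sum_card_inter (n := 1), mul_one]
  intro x _
  rw [card_eq_one]
  refine ⟨P.part x, ?_⟩
  ext A
  rw [mem_filter, mem_singleton]
  constructor
  · rintro ⟨hA, hx⟩
    exact (P.part_eq_of_mem hA hx).symm
  · rintro rfl
    simp

theorem card_parts_mul (hP : P.parts ⊆ powersetCard k univ) :
    #P.parts * k = Fintype.card α := by
  rw [← card_univ, ← P.sum_card_parts, sum_const_nat fun A hA ↦ (mem_powersetCard.1 (hP hA)).2]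

theorem card_parts_eq {Q : Finpartition (univ : Finset α)} (hk : 0 < k)
    (hP : P.parts ⊆ powersetCard k univ) (hQ : Q.parts ⊆ powersetCard k univ) :
    #P.parts = #Q.parts :=
  Nat.eq_of_mul_eq_mul_right hk ((card_parts_mul hP).trans (card_parts_mul hQ).symm)

theorem IsTransversal.card_eq (hX : IsTransversal P X) : #X = #P.parts := by
  rw [← sum_card_inter_parts P X, sum_congr rfl hX, card_eq_sum_ones]

theorem IsTransversal.of_card_inter_le (hle : ∀ A ∈ P.parts, #(X ∩ A) ≤ 1)
    (hX : #P.parts ≤ #X) : IsTransversal P X := by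
  refine (sum_eq_sum_iff_of_le hle).1 ?_
  rw [← card_eq_sum_ones]
  refine (hX.trans_eq (sum_card_inter_parts P X).symm).antisymm' ?_
  exact (sum_le_sum hle).trans_eq (card_eq_sum_ones _).symm

theorem IsTransversal.card_transversalFamily (hX : IsTransversal P X) :
    #(transversalFamily P X k) = (Fintype.card α - #P.parts).choose k + #P.parts := by
  have hdisj : Disjoint P.parts (powersetCard k Xᶜ) := by
    refine disjoint_left.2 fun A hA hAX ↦ ?_
    have := hX A hA
    rw [disjoint_iff_inter_eq_empty.1 (le_compl_iff_disjoint_right.1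
      (mem_powersetCard.1 hAX).1).symm] at this
    simp at this
  rw [transversalFamily, card_union_of_disjoint hdisj, card_powersetCard, card_compl, hX.card_eq,
    add_comm]

theorem IsTransversal.parts_subset_of_cover (hX : IsTransversal P X)
    (hS : S ⊆ transversalFamily P X k) (hcover : S.sup id = univ) : P.parts ⊆ S := by
  intro A hA
  obtain ⟨x, hx⟩ := card_eq_one.1 (hX A hA)
  obtain ⟨hxX, hxA⟩ := mem_inter.1 (hx ▸ mem_singleton_self x)
  obtain ⟨B, hBS, hxB⟩ := mem_sup.1 (hcover ▸ mem_univ x)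
  obtain hB | hB := mem_union.1 (hS hBS)
  · rwa [P.eq_of_mem_parts hA hB hxA hxB]
  · exact (mem_compl.1 ((mem_powersetCard.1 hB).1 hxB) hxX).elim

theorem isTransversal_of_injOn (hess : essentialPart F = P.parts)
    (hinj : Set.InjOn (fun x ↦ ({A ∈ F | x ∈ A} : Finset (Finset α))) X)
    (hX : ∀ x ∈ X, ∀ A ∈ F, x ∈ A → A ∈ essentialPart F) (hcard : #P.parts ≤ #X) :
    IsTransversal P X := by
  have star_eq : ∀ A ∈ P.parts, ∀ x ∈ X, x ∈ A → ({B ∈ F | x ∈ B} : Finset _) = {A} := by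
    intro A hA x hx hxA
    refine eq_singleton_iff_unique_mem.2 ⟨mem_filter.2 ⟨?_, hxA⟩, fun B hB ↦ ?_⟩
    · exact essentialPart_subset F (hess ▸ hA)
    · obtain ⟨hBF, hxB⟩ := mem_filter.1 hB
      exact P.eq_of_mem_parts (hess ▸ hX x hx B hBF hxB) hA hxB hxA
  refine .of_card_inter_le (fun A hA ↦ card_le_one.2 fun x hx y hy ↦ ?_) hcard
  rw [mem_inter] at hx hy
  exact hinj hx.1 hy.1 ((star_eq A hA x hx.1 hx.2).trans (star_eq A hA y hy.1 hy.2).symm)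

theorem subset_essentialPart_union (hF : F ⊆ powersetCard k univ)
    (hX : ∀ x ∈ X, ∀ A ∈ F, x ∈ A → A ∈ essentialPart F) :
    F ⊆ essentialPart F ∪ powersetCard k Xᶜ := by
  intro A hA
  rw [mem_union, or_iff_not_imp_left]
  exact fun hess ↦ mem_powersetCard.2 ⟨fun x hxA ↦ mem_compl.2 fun hxX ↦ hess (hX x hxX A hA hxA),
    (mem_powersetCard.1 (hF hA)).2⟩

theorem PartitionEfficient.card_le (hq : 2 ≤ q) (hk : 2 ≤ k) (hqk : (q, k) ≠ (2, 2))
    (hα : Fintype.card α = q * k) (hFk : F ⊆ powersetCard k univ) (hcover : F.sup id = univ)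
    (hF : PartitionEfficient F) :
    #F ≤ (q * k - q).choose k + q ∧ (#F = (q * k - q).choose k + q →
      ∃ P X, IsTransversal P X ∧ F = transversalFamily P X k) := by
  have : Nonempty α := Fintype.card_pos_iff.1 (hα ▸ by positivity)
  obtain ⟨P, hP⟩ := hF F subset_rfl hcover
  have hPcard : #P.parts = q :=
    Nat.eq_of_mul_eq_mul_right (by positivity) ((card_parts_mul (hP.trans hFk)).trans hα)
  have hPess := parts_subset_essentialPart hP
  obtain ⟨X, hXcard, hinj, hX⟩ := hF.exists_points
  have hXα : #X ≤ q * k := hα ▸ card_le_univ X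
  have hunion : #(essentialPart F ∪ powersetCard k Xᶜ) ≤
      #(essentialPart F) + (q * k - #X).choose k :=
    (card_union_le _ _).trans_eq (by rw [card_powersetCard, card_compl, hα])
  have hsub := subset_essentialPart_union hFk hX
  obtain ⟨hle, heq⟩ := hF.isCographOn.indepSetBound
    ((P.parts_nonempty univ_nonempty.ne_empty).mono hPess)
    (noDomination_essentialPart
      (Set.Sized.isAntichain (r := k) fun A hA ↦ (mem_powersetCard.1 (hFk hA)).2))
  rw [← hXcard] at hle heq
  obtain ⟨hbound, hbound_eq⟩ := add_choose_le hq hk hqk (hPcard ▸ card_le_card hPess)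
    (hle.trans hXα)
  have hmono := Nat.choose_le_choose k (Nat.sub_le_sub_left hle (q * k))
  have hFle := (card_le_card hsub).trans hunion
  refine ⟨by lia, fun hFcard ↦ ?_⟩
  have hess : #(essentialPart F) = q := by
    obtain h | ⟨h, hq⟩ := hbound_eq (by lia)
    · exact h
    · obtain ⟨a, b, hab, hPab⟩ := heq (by lia) _ (parts_mem_maximalCliques hP)
      grind
  have hess_eq : essentialPart F = P.parts :=
    (eq_of_subset_of_card_le hPess (by lia)).symm
  refine ⟨P, X, isTransversal_of_injOn hess_eq hinj hX (by lia), ?_⟩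
  rw [transversalFamily, ← hess_eq]
  exact eq_of_subset_of_card_le hsub (by lia)

theorem IsTransversal.exists_perm {P' : Finpartition (univ : Finset α)} {X' : Finset α}
    (hk : 0 < k) (hP : P.parts ⊆ powersetCard k univ) (hP' : P'.parts ⊆ powersetCard k univ)
    (hX : IsTransversal P X) (hX' : IsTransversal P' X') :
    ∃ σ : Equiv.Perm α, (∀ A ∈ P.parts, A.image σ ∈ P'.parts) ∧ ∀ x, σ x ∈ X' ↔ x ∈ X := by
  have e : P.parts ≃ P'.parts := Fintype.equivOfCardEq (by simpa using card_parts_eq hk hP hP')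
  let f (x : α) : P'.parts × Bool := (e ⟨P.part x, by simp⟩, decide (x ∈ X))
  let g (x : α) : P'.parts × Bool := (⟨P'.part x, by simp⟩, decide (x ∈ X'))
  have card_f (A : P.parts) (b : Bool) : #{x | f x = (e A, b)} = if b then 1 else k - 1 := by
    rw [← card_filter_decide_mem (mem_powersetCard.1 (hP A.2)).2 (hX A A.2)]
    congr 1
    ext x
    simp [f, Prod.ext_iff, Subtype.ext_iff, P.part_eq_iff_mem A.2]
  have card_g (A : P'.parts) (b : Bool) : #{x | g x = (A, b)} = if b then 1 else k - 1 := by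
    rw [← card_filter_decide_mem (mem_powersetCard.1 (hP' A.2)).2 (hX' A A.2)]
    congr 1
    ext x
    simp [g, Prod.ext_iff, Subtype.ext_iff, P'.part_eq_iff_mem A.2]
  have hfg (c : P'.parts × Bool) : Fintype.card {x // f x = c} = Fintype.card {x // g x = c} := by
    obtain ⟨A, b⟩ := c
    obtain ⟨A, rfl⟩ := e.surjective A
    rw [Fintype.card_subtype, Fintype.card_subtype, card_f, card_g]
  let σ : Equiv.Perm α := Equiv.ofFiberEquiv fun c ↦ Fintype.equivOfCardEq (hfg c)
  have hσ (x : α) : g (σ x) = f x := Equiv.ofFiberEquiv_map _ x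
  refine ⟨σ, fun A hA ↦ ?_, fun x ↦ by simpa [f, g] using congrArg Prod.snd (hσ x)⟩
  have himage : A.image σ = e ⟨A, hA⟩ := by
    refine eq_of_subset_of_card_le (image_subset_iff.2 fun x hx ↦ ?_) ?_
    · have hpart : P'.part (σ x) = e ⟨P.part x, by simp⟩ :=
        congrArg (fun c ↦ (c.1 : Finset α)) (hσ x)
      simp only [P.part_eq_of_mem hA hx] at hpart
      exact hpart ▸ P'.mem_part (mem_univ _)
    · rw [card_image_of_injective A σ.injective, (mem_powersetCard.1 (hP hA)).2,
        (mem_powersetCard.1 (hP' (e _).2)).2]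
  exact himage ▸ (e ⟨A, hA⟩).2

theorem IsTransversal.exists_image_transversalFamily_eq {P' : Finpartition (univ : Finset α)}
    {X' : Finset α} (hk : 0 < k) (hP : P.parts ⊆ powersetCard k univ)
    (hP' : P'.parts ⊆ powersetCard k univ) (hX : IsTransversal P X) (hX' : IsTransversal P' X') :
    ∃ σ : Equiv.Perm α,
      (transversalFamily P X k).image (fun A ↦ A.image σ) = transversalFamily P' X' k := by
  obtain ⟨σ, hσP, hσX⟩ := hX.exists_perm hk hP hP' hX'
  refine ⟨σ, eq_of_subset_of_card_le (image_subset_iff.2 fun A hA ↦ ?_) ?_⟩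
  · refine mem_union.2 ((mem_union.1 hA).imp (hσP A) fun hA ↦ ?_)
    obtain ⟨hAX, hAk⟩ := mem_powersetCard.1 hA
    refine mem_powersetCard.2 ⟨image_subset_iff.2 fun x hx ↦ ?_, ?_⟩
    · exact mem_compl.2 fun h ↦ mem_compl.1 (hAX hx) ((hσX x).1 h)
    · rw [card_image_of_injective A σ.injective, hAk]
  · rw [card_image_of_injective _ (image_injective σ.injective), hX.card_transversalFamily,
      hX'.card_transversalFamily, card_parts_eq hk hP hP']

end Transversal

section UnionEfficient

open Finset

theorem exists_finpartition_of_sum_card_le {α : Type*} [Fintype α] [DecidableEq α]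
    {T : Finset (Finset α)} (hcover : T.sup id = univ)
    (hcard : ∑ A ∈ T, #A ≤ Fintype.card α) :
    ∃ P : Finpartition (univ : Finset α), P.parts ⊆ T := by
  refine ⟨.ofErase T (supIndep_iff_disjoint_erase.2 fun A hA ↦ ?_) hcover, erase_subset _ T⟩
  have hunion : A ∪ (T.erase A).sup id = univ := by
    rw [← hcover, ← insert_erase hA, sup_insert, erase_insert (notMem_erase A T)]
    rfl
  have hrest : #((T.erase A).sup id) ≤ ∑ B ∈ T.erase A, #B := by
    rw [sup_eq_biUnion]
    exact card_biUnion_le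
  have hinter := card_union_add_card_inter A ((T.erase A).sup id)
  rw [hunion, card_univ] at hinter
  have := add_sum_erase T card hA
  exact disjoint_iff_inter_eq_empty.2 (card_eq_zero.1 (by dsimp only [id] at *; lia))

variable {n q k : ℕ} {F : Finset (Finset (Fin n))} {P : Finpartition (univ : Finset (Fin n))}
  {X : Finset (Fin n)}

theorem UnionEfficient.partitionEfficient (hn : n = q * k)
    (hFk : F ⊆ powersetCard k univ) (hF : UnionEfficient q F) : PartitionEfficient F := by
  intro S hS hcover
  obtain ⟨T, hTS, hTq, hT⟩ := hF S hS hcover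
  have hsum : ∑ A ∈ T, #A = q * k := by
    rw [sum_const_nat fun A hA ↦ (mem_powersetCard.1 (hFk (hS (hTS hA)))).2, hTq]
  obtain ⟨P, hP⟩ := exists_finpartition_of_sum_card_le hT (by rw [hsum, ← hn, Fintype.card_fin])
  exact ⟨P, hP.trans hTS⟩

theorem unionNontrivial_transversalFamily (P : Finpartition (univ : Finset (Fin n)))
    (X : Finset (Fin n)) (k : ℕ) : UnionNontrivial (transversalFamily P X k) :=
  univ_subset_iff.1 (P.sup_parts.ge.trans (sup_mono subset_union_left))

theorem IsTransversal.unionEfficient (hX : IsTransversal P X) :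
    UnionEfficient #P.parts (transversalFamily P X k) :=
  fun _ hS hcover ↦ ⟨P.parts, hX.parts_subset_of_cover hS hcover, rfl, P.sup_parts⟩

theorem mem_block {i : ℕ} {x : Fin n} : x ∈ block n k i ↔ x.val / k = i := by
  simp [block]

theorem map_block (hn : n = q * k) (hk : 0 < k) {i : ℕ} (hi : i < q) :
    (block n k i).map Fin.valEmbedding = Ico (i * k) ((i + 1) * k) := by
  have hle : (i + 1) * k ≤ n := hn ▸ Nat.mul_le_mul_right k hi
  ext x
  simp only [mem_map, mem_block, Fin.valEmbedding_apply, mem_Ico]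
  constructor
  · rintro ⟨y, rfl, rfl⟩
    exact ⟨Nat.div_mul_le_self y k, Nat.lt_mul_of_div_lt (Nat.lt_succ_self _) hk⟩
  · rintro ⟨h₁, h₂⟩
    exact ⟨⟨x, h₂.trans_le hle⟩, Nat.div_eq_of_lt_le h₁ h₂, rfl⟩

theorem card_block (hn : n = q * k) (hk : 0 < k) {i : ℕ} (hi : i < q) : #(block n k i) = k := by
  rw [← card_map Fin.valEmbedding, map_block hn hk hi, Nat.card_Ico, Nat.succ_mul,
    Nat.add_sub_cancel_left]

theorem exists_finpartition_block (hn : n = q * k) (hk : 0 < k) :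
    ∃ P : Finpartition (univ : Finset (Fin n)), P.parts = (range q).image (block n k) := by
  refine ⟨.ofExistsUnique ((range q).image (block n k)) (fun A _ ↦ subset_univ A) ?_ ?_, rfl⟩
  · intro x _
    refine ⟨block n k (x / k), ⟨mem_image_of_mem _ (mem_range.2 ?_), mem_block.2 rfl⟩, ?_⟩
    · exact Nat.div_lt_of_lt_mul (by rw [mul_comm, ← hn]; exact x.2)
    · rintro A ⟨hA, hx⟩
      obtain ⟨i, -, rfl⟩ := mem_image.1 hA
      rw [mem_block.1 hx]
  · rw [mem_image]
    rintro ⟨i, hi, hempty⟩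
    have := card_block hn hk (mem_range.1 hi)
    rw [hempty, card_empty] at this
    exact hk.ne this

theorem card_multiples_inter_block (hn : n = q * k) (hk : 0 < k) {i : ℕ} (hi : i < q) :
    #(({x | k ∣ x.val} : Finset (Fin n)) ∩ block n k i) = 1 := by
  refine card_eq_one.2 ⟨⟨i * k, hn ▸ Nat.mul_lt_mul_of_pos_right hi hk⟩, ?_⟩
  ext x
  simp only [mem_inter, mem_filter, mem_univ, true_and, mem_block, mem_singleton, Fin.ext_iff]
  constructor
  · rintro ⟨hx, rfl⟩
    exact (Nat.div_mul_cancel hx).symm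
  · intro hx
    simp [hx, hk]

theorem exists_extremalFamily_eq_transversalFamily (hn : n = q * k) (hk : 0 < k) :
    ∃ P X, #P.parts = q ∧ P.parts ⊆ powersetCard k univ ∧ IsTransversal P X ∧
      extremalFamily n q k = transversalFamily P X k := by
  obtain ⟨P, hP⟩ := exists_finpartition_block hn hk
  have mem_parts {A : Finset (Fin n)} (hA : A ∈ P.parts) : ∃ i < q, block n k i = A := by
    simpa [hP] using hA
  have hPk : P.parts ⊆ powersetCard k univ := by
    intro A hA
    obtain ⟨i, hi, rfl⟩ := mem_parts hA
    exact mem_powersetCard_univ.2 (card_block hn hk hi)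
  refine ⟨P, ({x | k ∣ x.val} : Finset (Fin n)), ?_, hPk, fun A hA ↦ ?_, ?_⟩
  · exact Nat.eq_of_mul_eq_mul_right hk (by rw [card_parts_mul hPk, Fintype.card_fin, hn])
  · obtain ⟨i, hi, rfl⟩ := mem_parts hA
    exact card_multiples_inter_block hn hk hi
  · rw [extremalFamily, transversalFamily, hP, compl_filter]

theorem extremalFamily_subset_powersetCard (hn : n = q * k) (hk : 0 < k) :
    extremalFamily n q k ⊆ powersetCard k univ := by
  obtain ⟨P, X, -, hPk, -, hE⟩ := exists_extremalFamily_eq_transversalFamily hn hk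
  exact hE ▸ transversalFamily_subset_powersetCard hPk

theorem unionNontrivial_extremalFamily (hn : n = q * k) (hk : 0 < k) :
    UnionNontrivial (extremalFamily n q k) := by
  obtain ⟨P, X, -, -, -, hE⟩ := exists_extremalFamily_eq_transversalFamily hn hk
  exact hE ▸ unionNontrivial_transversalFamily P X k

theorem unionEfficient_extremalFamily (hn : n = q * k) (hk : 0 < k) :
    UnionEfficient q (extremalFamily n q k) := by
  obtain ⟨P, X, rfl, -, hX, hE⟩ := exists_extremalFamily_eq_transversalFamily hn hk
  exact hE ▸ hX.unionEfficient

theorem card_extremalFamily (hn : n = q * k) (hk : 0 < k) :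
    #(extremalFamily n q k) = (n - q).choose k + q := by
  obtain ⟨P, X, hPq, -, hX, hE⟩ := exists_extremalFamily_eq_transversalFamily hn hk
  rw [hE, hX.card_transversalFamily, hPq, Fintype.card_fin]

theorem IsTransversal.familyIso_extremalFamily (hn : n = q * k) (hk : 0 < k)
    (hP : P.parts ⊆ powersetCard k univ) (hX : IsTransversal P X) :
    FamilyIso (transversalFamily P X k) (extremalFamily n q k) := by
  obtain ⟨P', X', -, hP', hX', hE⟩ := exists_extremalFamily_eq_transversalFamily hn hk
  exact hE ▸ hX.exists_image_transversalFamily_eq hk hP hP' hX'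

theorem UnionEfficient.card_le (hq : 2 ≤ q) (hk : 2 ≤ k) (hqk : (q, k) ≠ (2, 2)) (hn : n = q * k)
    (hFk : F ⊆ powersetCard k univ) (hcover : UnionNontrivial F) (hF : UnionEfficient q F) :
    #F ≤ (n - q).choose k + q ∧
      (#F = (n - q).choose k + q → FamilyIso F (extremalFamily n q k)) := by
  obtain ⟨hle, heq⟩ := (hF.partitionEfficient hn hFk).card_le hq hk hqk (by simpa) hFk hcover
  rw [← hn] at hle heq
  refine ⟨hle, fun hcard ↦ ?_⟩
  obtain ⟨P, X, hX, rfl⟩ := heq hcard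
  exact hX.familyIso_extremalFamily hn (by positivity) (subset_union_left.trans hFk)

end UnionEfficient

section Complement

open Finset

variable {n q k l : ℕ} {F G S : Finset (Finset (Fin n))}

theorem complFamily_complFamily (F : Finset (Finset (Fin n))) :
    complFamily (complFamily F) = F := by
  simp [complFamily, image_image, Function.comp_def]

theorem card_complFamily (F : Finset (Finset (Fin n))) : #(complFamily F) = #F :=
  card_image_of_injective F compl_injective

theorem complFamily_mono (h : F ⊆ G) : complFamily F ⊆ complFamily G :=
  image_subset_image h

theorem complFamily_subset_powersetCard (hn : n = k + l) (hF : F ⊆ powersetCard k univ) :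
    complFamily F ⊆ powersetCard l univ := by
  refine image_subset_iff.2 fun A hA ↦ mem_powersetCard_univ.2 ?_
  rw [card_univ_sdiff, mem_powersetCard_univ.1 (hF hA), Fintype.card_fin, hn,
    Nat.add_sub_cancel_left]

theorem exists_mem_complFamily_iff :
    (∃ x, ∀ A ∈ complFamily F, x ∈ A) ↔ F.sup id ≠ univ := by
  simp [complFamily, eq_univ_iff_forall, mem_sup]

theorem interNontrivial_complFamily : InterNontrivial (complFamily F) ↔ UnionNontrivial F := by
  rw [InterNontrivial, exists_mem_complFamily_iff, not_not, UnionNontrivial]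

theorem linked_complFamily_iff : Linked q (complFamily S) ↔
    ¬ ∃ A : Fin q → Finset (Fin n), (∀ i, A i ∈ S) ∧ univ.sup A = univ := by
  have mem_compl_iff (A : Finset (Fin n)) : univ \ A ∈ complFamily S ↔ A ∈ S :=
    Function.Injective.mem_finset_image compl_injective
  constructor
  · rintro h ⟨A, hA, hcover⟩
    obtain ⟨x, hx⟩ := h (fun i ↦ univ \ A i) fun i ↦ (mem_compl_iff _).2 (hA i)
    obtain ⟨i, -, hi⟩ := mem_sup.1 (hcover ▸ mem_univ x)
    exact (mem_sdiff.1 (hx i)).2 hi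
  · intro h A hA
    by_contra! hinter
    refine h ⟨fun i ↦ univ \ A i, fun i ↦ ?_, eq_univ_of_forall fun x ↦ ?_⟩
    · rw [← mem_compl_iff, Finset.sdiff_sdiff_eq_self (subset_univ _)]
      exact hA i
    · obtain ⟨i, hi⟩ := hinter x
      exact mem_sup.2 ⟨i, mem_univ i, mem_sdiff.2 ⟨mem_univ x, hi⟩⟩

/-- A repetition among the sets of a covering `q`-tuple is impossible, since `q - 1` sets of size
`k` cannot cover `q * k` points. -/
theorem exists_cover_tuple_iff (hn : n = q * k) (hk : 0 < k) (hS : S ⊆ powersetCard k univ) :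
    (∃ A : Fin q → Finset (Fin n), (∀ i, A i ∈ S) ∧ univ.sup A = univ) ↔
      ∃ T ⊆ S, #T = q ∧ T.sup id = univ := by
  constructor
  · rintro ⟨A, hA, hcover⟩
    have hAS : univ.image A ⊆ S := image_subset_iff.2 fun i _ ↦ hA i
    have hsup : (univ.image A).sup id = univ := by rwa [sup_image, Function.id_comp]
    refine ⟨_, hAS, (card_image_le.trans_eq (card_fin q)).antisymm ?_, hsup⟩
    refine Nat.le_of_mul_le_mul_right ?_ hk
    calc q * k = #((univ.image A).biUnion id) := by
          rw [← sup_eq_biUnion, hsup, card_univ, Fintype.card_fin, hn]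
      _ ≤ #(univ.image A) * k := card_biUnion_le_card_mul _ _ _ fun B hB ↦
          (mem_powersetCard_univ.1 (hS (hAS hB))).le
  · rintro ⟨T, hTS, hTq, hT⟩
    let e := (T.equivFinOfCardEq hTq).symm
    refine ⟨fun i ↦ e i, fun i ↦ hTS (e i).2, eq_univ_of_forall fun x ↦ ?_⟩
    obtain ⟨A, hA, hxA⟩ := mem_sup.1 (hT ▸ mem_univ x)
    exact mem_sup.2 ⟨e.symm ⟨A, hA⟩, mem_univ _, by simpa using hxA⟩

theorem hellyFamily_complFamily (hn : n = q * k) (hk : 0 < k) (hF : F ⊆ powersetCard k univ) :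
    HellyFamily q (complFamily F) ↔ UnionEfficient q F := by
  have linked_imp_iff (S) (hS : S ⊆ F) :
      (Linked q (complFamily S) → ∃ x, ∀ A ∈ complFamily S, x ∈ A) ↔
        (S.sup id = univ → ∃ T ⊆ S, #T = q ∧ T.sup id = univ) := by
    rw [← exists_cover_tuple_iff hn hk (hS.trans hF), exists_mem_complFamily_iff,
      linked_complFamily_iff, ne_eq, not_imp_not]
  constructor
  · exact fun h S hS ↦ (linked_imp_iff S hS).1 (h _ (complFamily_mono hS))
  · intro h S hS
    have hS' := complFamily_complFamily F ▸ complFamily_mono hS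
    simpa only [complFamily_complFamily] using (linked_imp_iff _ hS').2 (h _ hS')

theorem FamilyIso.complFamily (h : FamilyIso F G) :
    FamilyIso (complFamily F) (complFamily G) := by
  obtain ⟨σ, rfl⟩ := h
  refine ⟨σ, ?_⟩
  simp only [_root_.complFamily, image_image]
  refine image_congr fun A _ ↦ ?_
  simp [image_sdiff _ _ σ.injective]

theorem HellyFamily.card_le (hq : 2 ≤ q) (hk : 2 ≤ k) (hqk : (q, k) ≠ (2, 2)) (hn : n = q * k)
    (hFk : F ⊆ powersetCard ((q - 1) * k) univ) (hinter : InterNontrivial F)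
    (hF : HellyFamily q F) :
    #F ≤ (n - q).choose k + q ∧ (#F = (n - q).choose k + q →
      FamilyIso F (complFamily (extremalFamily n q k))) := by
  have hk₀ : 0 < k := by positivity
  rw [← complFamily_complFamily F] at hinter hF
  have hFk' : complFamily F ⊆ powersetCard k univ :=
    complFamily_subset_powersetCard
      (by rw [hn, ← Nat.succ_mul, Nat.succ_eq_add_one, Nat.sub_add_cancel (by lia)]) hFk
  obtain ⟨hle, heq⟩ := ((hellyFamily_complFamily hn hk₀ hFk').1 hF).card_le hq hk hqk hn hFk'
    (interNontrivial_complFamily.1 hinter)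
  rw [card_complFamily] at hle heq
  refine ⟨hle, fun hcard ↦ ?_⟩
  simpa only [complFamily_complFamily] using (heq hcard).complFamily

end Complement

theorem theorem1p7 (n q k : ℕ) (hq : 2 ≤ q) (hk : 2 ≤ k) (hqk : (q, k) ≠ (2, 2))
    (hn : n = q * k) :
    -- the union form: upper bound and uniqueness
    (∀ F : Finset (Finset (Fin n)), F ⊆ Finset.powersetCard k Finset.univ →
      UnionNontrivial F → UnionEfficient q F →
        F.card ≤ (n - q).choose k + q ∧
        (F.card = (n - q).choose k + q → FamilyIso F (extremalFamily n q k))) ∧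
    -- the union form: the extremal family is admissible and attains the bound
    (extremalFamily n q k ⊆ Finset.powersetCard k Finset.univ ∧
      UnionNontrivial (extremalFamily n q k) ∧ UnionEfficient q (extremalFamily n q k) ∧
      (extremalFamily n q k).card = (n - q).choose k + q) ∧
    -- the Helly form, for sets of size (q - 1) k, that is, n = ((q - 1) k) q / (q - 1)
    (∀ H : Finset (Finset (Fin n)), H ⊆ Finset.powersetCard ((q - 1) * k) Finset.univ →
      InterNontrivial H → HellyFamily q H →
        H.card ≤ (n - q).choose k + q ∧
        (H.card = (n - q).choose k + q →
          FamilyIso H (complFamily (extremalFamily n q k)))) ∧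
    (complFamily (extremalFamily n q k) ⊆ Finset.powersetCard ((q - 1) * k) Finset.univ ∧
      InterNontrivial (complFamily (extremalFamily n q k)) ∧
      HellyFamily q (complFamily (extremalFamily n q k)) ∧
      (complFamily (extremalFamily n q k)).card = (n - q).choose k + q) := by
  have hk₀ : 0 < k := by positivity
  have hE := extremalFamily_subset_powersetCard hn hk₀
  have hcover := unionNontrivial_extremalFamily hn hk₀
  have heff := unionEfficient_extremalFamily hn hk₀
  have hcard := card_extremalFamily hn hk₀
  refine ⟨fun F hFk hcov hF ↦ hF.card_le hq hk hqk hn hFk hcov, ⟨hE, hcover, heff, hcard⟩,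
    fun H hHk hinter hH ↦ hH.card_le hq hk hqk hn hHk hinter, ?_,
    interNontrivial_complFamily.2 hcover, (hellyFamily_complFamily hn hk₀ hE).2 heff,
    (card_complFamily _).trans hcard⟩
  refine complFamily_subset_powersetCard ?_ hE
  rw [hn, add_comm, ← Nat.succ_mul, Nat.succ_eq_add_one, Nat.sub_add_cancel (by lia)]
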